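/- Let $\Bbbk$ be a field, let $n\ge 1$, and let $P=\Bbbk[x_1,\ldots,x_n]$ be the polynomial ring with the standard grading. For a homogeneous ideal $J\subseteq P$ and $d \geq 0$ put $H(J,d)=\dim_{\Bbbk} J_d$, where $J_d$ is the space of elements of $J$ that are homogeneous of degree $d$. A homogeneous ideal $I\subseteq P$ generated by homogeneous polynomials of degree $d$ is called Gotzmann (in degree $d$) if $H(I,d+1)\le H(J,d+1)$ for every homogeneous ideal $J\subseteq P$ with $H(J,d)=H(I,d)$; the zero ideal is generated in every degree by the empty set. Let $G$ be a simple graph with vertex set $\{x_1,\ldots,x_n\}$ and edge set $E$, and let $I(G)=(x_ix_j \mid \{x_i,x_j\}\in E)\subseteq P$ be its edge ideal, which is generated in degree $2$. Then $I(G)$ is Gotzmann (in degree $2$) if and only if $G$ is a star, that is, there is a vertex of $G$ whose degree equals the number of edges of $G$ (equivalently, which lies on every edge; in particular a graph without edges is a star). -/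

import Mathlib

attribute [local instance] MvPolynomial.gradedAlgebra

noncomputable section

namespace GotzmannEdge

/-- The Hilbert function `H(I, d) = dim_k I_d`, where `I_d` is the `k`-space of all elements of `I`
that are homogeneous of degree `d` (for the standard grading). -/
def hilbertFun {σ k : Type*} [Field k] (I : Ideal (MvPolynomial σ k)) (d : ℕ) : ℕ :=
  Module.finrank k
    ↥(I.restrictScalars k ⊓ MvPolynomial.homogeneousSubmodule σ k d)

/-- `I` is generated, as an ideal, by forms of degree `d` (the zero ideal has the empty set of
generators, so it is generated in every degree). -/
def GeneratedInDegree {σ k : Type*} [Field k] (I : Ideal (MvPolynomial σ k)) (d : ℕ) : Prop :=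
  ∃ S : Set (MvPolynomial σ k), (∀ f ∈ S, f.IsHomogeneous d) ∧ I = Ideal.span S

/-- `I` is a `d`-Gotzmann ideal: a homogeneous ideal generated in degree `d` that has the smallest
dimension in degree `d + 1` out of all homogeneous ideals with the same dimension in degree `d`. -/
def IsGotzmann {σ k : Type*} [Field k] (I : Ideal (MvPolynomial σ k)) (d : ℕ) : Prop :=
  I.IsHomogeneous (MvPolynomial.homogeneousSubmodule σ k) ∧
  GeneratedInDegree I d ∧
  ∀ J : Ideal (MvPolynomial σ k),
    J.IsHomogeneous (MvPolynomial.homogeneousSubmodule σ k) →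
    hilbertFun I d = hilbertFun J d →
    hilbertFun I (d + 1) ≤ hilbertFun J (d + 1)

/-- The edge ideal `I(G) = (x_i x_j | {x_i, x_j} ∈ E(G))`. -/
def edgeIdeal (k : Type*) [Field k] {V : Type*} (G : SimpleGraph V) :
    Ideal (MvPolynomial V k) :=
  Ideal.span {f | ∃ i j : V, G.Adj i j ∧ f = MvPolynomial.X i * MvPolynomial.X j}

open Classical in
/-- `G` is a star: some vertex has degree equal to the number of edges of `G`. -/
def IsStar {V : Type*} [Fintype V] (G : SimpleGraph V) : Prop :=
  ∃ v : V, G.degree v = G.edgeFinset.card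

end GotzmannEdge

end

/-! The monomials outside `edgeIdeal k G` are those whose support is a clique for the reflexive
symmetric relation R = non-adjacency, so both degrees of the Hilbert function become counts
`cliqueExps`. If degree 2 has c = C(M+1,2) + b of them with b ≤ M, Macaulay's growth value is g(c) =
C(M+2,3) + C(b+1,2).

A non-star has strictly fewer than g(c) in degree 3 (`card_cliqueExps_three_le`: delete a vertex of
least degree and use superadditivity of g, tracking equality). Some monomial ideal with the same
dimension in degree 2 attains g(c) in its complement (`exists_isHomogeneous_hilbertFun`), hence is
smaller in degree 3, so the edge ideal is not Gotzmann.

For a star with m edges, the dimension in degree 3 is exactly nm - C(m,2). Passing to leading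
exponents shows that every ideal with m independent quadrics has at least this dimension
(`card_mul_hilbertFun_le`), since two distinct monomials of equal degree share at most one multiple
one degree up. -/

noncomputable section

namespace GotzmannEdge

open Finset

/-! ### Counting monomials supported on cliques -/

section CliqueExponents

variable {V : Type*}

open Classical in
theorem support_add_single (t : V →₀ ℕ) (v : V) :
    (t + Finsupp.single v 1).support = insert v t.support := by
  ext i
  by_cases h : i = v
  · simp [h]
  · simp [h]

variable [Fintype V]

open Classical in
/-- The exponents of degree `k` supported on a subset of `W` whose elements are pairwise
related by `R`. -/
def cliqueExps (R : V → V → Prop) (W : Finset V) (k : ℕ) : Finset (V →₀ ℕ) :=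
  (finsuppAntidiag univ k).filter
    fun t => t.support ⊆ W ∧ ∀ i ∈ t.support, ∀ j ∈ t.support, R i j

theorem mem_cliqueExps {R : V → V → Prop} {W : Finset V} {k : ℕ} {t : V →₀ ℕ} :
    t ∈ cliqueExps R W k ↔
      t.degree = k ∧ t.support ⊆ W ∧ ∀ i ∈ t.support, ∀ j ∈ t.support, R i j := by
  classical
  simp [cliqueExps, Finsupp.degree_eq_sum]

variable {R : V → V → Prop}

-- A clique monomial either avoids v, or is v times a clique monomial on the closed R-neighbourhood
-- of v; reflexivity permits further powers of v.
open Classical in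
theorem card_cliqueExps_succ (hr : ∀ i, R i i) (hs : ∀ i j, R i j → R j i) (W : Finset V)
    {v : V} (hv : v ∈ W) (k : ℕ) :
    #(cliqueExps R W (k + 1)) =
      #(cliqueExps R (W.erase v) (k + 1)) + #(cliqueExps R (W.filter (R v)) k) := by
  have hinj : Function.Injective fun t : V →₀ ℕ => t + Finsupp.single v 1 :=
    add_left_injective _
  rw [← card_image_of_injective (cliqueExps R (W.filter (R v)) k) hinj, ← card_union_of_disjoint]
  · congr 1
    ext t
    simp only [mem_union, mem_image, mem_cliqueExps]
    constructor
    · rintro ⟨hd, hW, hc⟩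
      by_cases htv : v ∈ t.support
      · right
        have hle : Finsupp.single v 1 ≤ t := by
          rw [Finsupp.single_le_iff]
          exact Nat.one_le_iff_ne_zero.mpr (Finsupp.mem_support_iff.mp htv)
        obtain ⟨u, rfl⟩ := exists_add_of_le hle
        rw [add_comm] at hd hW hc htv
        rw [support_add_single] at hW hc
        refine ⟨u, ⟨?_, ?_, ?_⟩, add_comm _ _⟩
        · simpa using hd
        · intro i hi
          exact mem_filter.mpr ⟨hW (mem_insert_of_mem hi),
            hc v (mem_insert_self _ _) i (mem_insert_of_mem hi)⟩
        · exact fun i hi j hj => hc i (mem_insert_of_mem hi) j (mem_insert_of_mem hj)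
      · left
        exact ⟨hd, fun i hi => mem_erase.mpr ⟨fun h => htv (h ▸ hi), hW hi⟩, hc⟩
    · rintro (⟨hd, hW, hc⟩ | ⟨u, ⟨hd, hW, hc⟩, rfl⟩)
      · exact ⟨hd, hW.trans (erase_subset _ _), hc⟩
      · rw [support_add_single]
        refine ⟨by simp [hd], ?_, ?_⟩
        · exact insert_subset hv (hW.trans (filter_subset _ _))
        · intro i hi j hj
          rcases mem_insert.mp hi with rfl | hi' <;> rcases mem_insert.mp hj with rfl | hj'
          · exact hr _
          · exact (mem_filter.mp (hW hj')).2
          · exact hs _ _ (mem_filter.mp (hW hi')).2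
          · exact hc _ hi' _ hj'
  · rw [disjoint_left]
    intro t ht ht'
    obtain ⟨u, -, rfl⟩ := mem_image.mp ht'
    have := (mem_cliqueExps.mp ht).2.1
    rw [support_add_single] at this
    exact notMem_erase v W (this (mem_insert_self _ _))

theorem card_cliqueExps_zero (W : Finset V) : #(cliqueExps R W 0) = 1 := by
  rw [card_eq_one]
  refine ⟨0, ?_⟩
  ext t
  simp only [mem_cliqueExps, mem_singleton, Finsupp.degree_eq_zero_iff]
  constructor
  · exact fun h => h.1
  · rintro rfl
    simp

theorem card_cliqueExps_empty (k : ℕ) : #(cliqueExps R (∅ : Finset V) (k + 1)) = 0 := by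
  rw [card_eq_zero, eq_empty_iff_forall_notMem]
  intro t ht
  obtain ⟨hd, hW, -⟩ := mem_cliqueExps.mp ht
  rw [subset_empty, Finsupp.support_eq_empty] at hW
  simp [hW] at hd

theorem card_cliqueExps_one (hr : ∀ i, R i i) (hs : ∀ i j, R i j → R j i) (W : Finset V) :
    #(cliqueExps R W 1) = #W := by
  classical
  induction W using Finset.induction_on with
  | empty => rw [card_cliqueExps_empty, card_empty]
  | insert v W hv ih =>
    rw [card_cliqueExps_succ hr hs _ (mem_insert_self v W), erase_insert hv, ih,
      card_cliqueExps_zero, card_insert_of_notMem hv]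

open Classical in
theorem card_cliqueExps_two (hr : ∀ i, R i i) (hs : ∀ i j, R i j → R j i) (W : Finset V)
    {v : V} (hv : v ∈ W) :
    #(cliqueExps R W 2) = #(cliqueExps R (W.erase v) 2) + #(W.filter (R v)) := by
  rw [card_cliqueExps_succ hr hs W hv, card_cliqueExps_one hr hs]

theorem card_cliqueExps_of_pairwise (hr : ∀ i, R i i) (hs : ∀ i j, R i j → R j i) (k : ℕ)
    (W : Finset V) (hW : ∀ i ∈ W, ∀ j ∈ W, R i j) :
    #(cliqueExps R W (k + 1)) = (#W + k).choose (k + 1) := by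
  classical
  induction k generalizing W with
  | zero => simp [card_cliqueExps_one hr hs]
  | succ k ihk =>
    induction W using Finset.induction_on with
    | empty => simp [card_cliqueExps_empty]
    | insert v W hv ih =>
      have hf : (insert v W).filter (R v) = insert v W :=
        filter_true_of_mem fun j hj => hW v (mem_insert_self _ _) j hj
      rw [card_cliqueExps_succ hr hs _ (mem_insert_self v W), erase_insert hv, hf, ihk _ hW,
        ih fun i hi j hj => hW i (mem_insert_of_mem hi) j (mem_insert_of_mem hj),
        card_insert_of_notMem hv, show #W + 1 + (k + 1) = (#W + (k + 1)) + 1 by ring,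
        Nat.choose_succ_succ (#W + (k + 1)) (k + 1), add_comm]
      congr 2
      ring

theorem card_cliqueExps_two_le (hr : ∀ i, R i i) (hs : ∀ i j, R i j → R j i) (W : Finset V) :
    #(cliqueExps R W 2) ≤ (#W + 1).choose 2 := by
  classical
  induction W using Finset.induction_on with
  | empty => simp [card_cliqueExps_empty]
  | insert v W hv ih =>
    rw [card_cliqueExps_two hr hs _ (mem_insert_self v W), erase_insert hv]
    have h := card_filter_le (insert v W) (R v)
    rw [card_insert_of_notMem hv] at h ⊢
    rw [Nat.choose_succ_succ (#W + 1) 1, Nat.choose_one_right]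
    lia

theorem card_cliqueExps_two_lt (hr : ∀ i, R i i) (hs : ∀ i j, R i j → R j i) {W : Finset V}
    {i j : V} (hi : i ∈ W) (hj : j ∈ W) (hij : ¬ R i j) :
    #(cliqueExps R W 2) < (#W + 1).choose 2 := by
  classical
  rw [card_cliqueExps_two hr hs _ hi]
  have h1 := card_cliqueExps_two_le hr hs (W.erase i)
  have h2 : #(W.filter (R i)) < #W :=
    card_lt_card (filter_ssubset.mpr ⟨j, hj, hij⟩)
  have h3 := card_erase_add_one hi
  rw [h3] at h1
  rw [Nat.choose_succ_succ (#W) 1, Nat.choose_one_right]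
  simp only [Nat.succ_eq_add_one] at *
  lia

-- Deleting a vertex shrinks each closed neighbourhood by at most one, so successive deletions
-- contribute at least s, s-1, ..., 1.
open Classical in
theorem choose_le_card_cliqueExps_two (hr : ∀ i, R i i) (hs : ∀ i j, R i j → R j i) (s : ℕ)
    (W : Finset V) (hW : s ≤ #W) (hdeg : ∀ w ∈ W, s ≤ #(W.filter (R w))) :
    (s + 1).choose 2 ≤ #(cliqueExps R W 2) := by
  induction s generalizing W with
  | zero => simp
  | succ s ih =>
    obtain ⟨v, hv⟩ : W.Nonempty := card_pos.mp (by lia)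
    rw [card_cliqueExps_two hr hs _ hv, Nat.choose_succ_succ (s + 1) 1, Nat.choose_one_right]
    have h1 := card_erase_add_one hv
    have h2 := ih (W.erase v) (by lia) fun w hw => by
      have h3 := hdeg w (mem_of_mem_erase hw)
      have h4 := pred_card_le_card_erase (s := W.filter (R w)) (a := v)
      rw [filter_erase]
      lia
    have h5 := hdeg v hv
    simp only [Nat.succ_eq_add_one] at *
    lia

end CliqueExponents

/-! ### Arithmetic of degree-two Macaulay representations -/

theorem two_mul_choose_two (x : ℕ) : 2 * (x + 1).choose 2 = (x + 1) * x := by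
  rw [Nat.choose_two_right, Nat.add_sub_cancel, mul_comm (x + 1) x]
  exact Nat.mul_div_cancel' (Nat.even_mul_succ_self x).two_dvd

theorem exists_eq_choose_two_add (c : ℕ) : ∃ M b, b ≤ M ∧ c = (M + 1).choose 2 + b := by
  induction c with
  | zero => exact ⟨0, 0, le_rfl, by simp⟩
  | succ c ih =>
    obtain ⟨M, b, hb, rfl⟩ := ih
    rcases hb.lt_or_eq with h | rfl
    · exact ⟨M, b + 1, h, rfl⟩
    · refine ⟨b + 1, 0, by simp, ?_⟩
      rw [Nat.choose_succ_succ (b + 1) 1, Nat.choose_one_right]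
      simp only [Nat.succ_eq_add_one]
      ring

theorem le_of_choose_two_add_eq {M b M' b' : ℕ} (hb : b ≤ M)
    (h : (M + 1).choose 2 + b = (M' + 1).choose 2 + b') : M' ≤ M := by
  by_contra! hlt
  have h1 : (M + 2).choose 2 ≤ (M' + 1).choose 2 := Nat.choose_le_choose 2 (by lia)
  rw [Nat.choose_succ_succ (M + 1) 1, Nat.choose_one_right] at h1
  simp only [Nat.succ_eq_add_one] at *
  lia

theorem choose_two_add_inj {M b M' b' : ℕ} (hb : b ≤ M) (hb' : b' ≤ M')
    (h : (M + 1).choose 2 + b = (M' + 1).choose 2 + b') : M = M' ∧ b = b' := by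
  obtain rfl : M = M' :=
    le_antisymm (le_of_choose_two_add_eq hb' h.symm) (le_of_choose_two_add_eq hb h)
  exact ⟨rfl, by lia⟩

/-- Superadditivity of Macaulay's growth function from degree two to degree three. -/
theorem choose_three_add_le {M b M' b' s : ℕ} (hb : b ≤ M) (hb' : b' ≤ M') (hs : s ≤ M' + 1)
    (h : (M' + 1).choose 2 + b' + s = (M + 1).choose 2 + b) :
    (M' + 2).choose 3 + (b' + 1).choose 2 + (s + 1).choose 2 ≤
        (M + 2).choose 3 + (b + 1).choose 2 ∧
      (0 < b' → 0 < s → s < M' + 1 →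
        (M' + 2).choose 3 + (b' + 1).choose 2 + (s + 1).choose 2 <
          (M + 2).choose 3 + (b + 1).choose 2) := by
  have e1 := two_mul_choose_two b'
  have e2 := two_mul_choose_two s
  have e3 := two_mul_choose_two b
  rcases le_or_gt (b' + s) M' with hc | hc
  -- No carry: M = M', b = b' + s, and the gap is b' * s.
  · obtain ⟨rfl, rfl⟩ := choose_two_add_inj hb hc (by rw [← h]; ring)
    refine ⟨by nlinarith, fun h1 h2 _ => by nlinarith [Nat.mul_pos h1 h2]⟩
  · obtain ⟨d, hd⟩ := Nat.exists_eq_add_of_le hc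
    have hd' : b' + s = M' + 1 + d := hd
    have e4 := two_mul_choose_two (M' + 1)
    have e5 : (M' + 2).choose 2 = (M' + 1).choose 2 + (M' + 1) := by
      rw [Nat.choose_succ_succ (M' + 1) 1, Nat.choose_one_right, add_comm]
    have e6 : (M' + 3).choose 3 = (M' + 2).choose 3 + (M' + 2).choose 2 := by
      rw [Nat.choose_succ_succ (M' + 2) 2, add_comm]
    obtain ⟨rfl, rfl⟩ := choose_two_add_inj hb (show d ≤ M' + 1 by lia)
      (by rw [← h]; change _ = (M' + 2).choose 2 + d; lia)
    obtain ⟨p, hp⟩ := Nat.exists_eq_add_of_le hs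
    obtain ⟨q, hq⟩ := Nat.exists_eq_add_of_le hb'
    obtain rfl : s = b + q + 1 := by lia
    obtain rfl : M' = b' + q := hq
    obtain rfl : b' = b + p := by lia
    rw [show b + p + q + 1 + 2 = b + p + q + 3 by ring]
    -- After the carry the gap is p * (q + 1), where p = M' + 1 - s.
    refine ⟨by nlinarith [Nat.zero_le (p * q)], fun _ _ h3 => ?_⟩
    have hp : 0 < p := by lia
    nlinarith [Nat.zero_le (p * q)]

/-! ### Growth of clique counts, with the equality case -/

section

variable {V : Type*} [Fintype V] {R : V → V → Prop}

open Classical in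
theorem card_cliqueExps_two_of_center (hr : ∀ i, R i i) (hs : ∀ i j, R i j → R j i)
    {W : Finset V} {u : V} (hu : u ∈ W)
    (hstar : ∀ i ∈ W, ∀ j ∈ W, ¬ R i j → i = u ∨ j = u) :
    #(cliqueExps R W 2) = (#W).choose 2 + #(W.filter (R u)) := by
  rw [card_cliqueExps_two hr hs _ hu, card_cliqueExps_of_pairwise hr hs 1, card_erase_add_one hu]
  intro i hi j hj
  by_contra hij
  rcases hstar i (mem_of_mem_erase hi) j (mem_of_mem_erase hj) hij with rfl | rfl
  · exact notMem_erase _ _ hi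
  · exact notMem_erase _ _ hj

/-- Induction on W, deleting a vertex v with the smallest closed neighbourhood. Equality would need
equality for W minus v, a clique around v, and equality in superadditivity. -/
theorem card_cliqueExps_three_le [Nonempty V] (hr : ∀ i, R i i) (hs : ∀ i j, R i j → R j i)
    (W : Finset V) {M b : ℕ} (hb : b ≤ M) (h2 : #(cliqueExps R W 2) = (M + 1).choose 2 + b) :
    #(cliqueExps R W 3) ≤ (M + 2).choose 3 + (b + 1).choose 2 ∧
      ((¬ ∃ u, ∀ i ∈ W, ∀ j ∈ W, ¬ R i j → i = u ∨ j = u) →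
        #(cliqueExps R W 3) < (M + 2).choose 3 + (b + 1).choose 2) := by
  classical
  induction hn : #W generalizing W M b with
  | zero =>
    rw [card_eq_zero] at hn
    subst hn
    rw [card_cliqueExps_empty]
    exact ⟨Nat.zero_le _, fun h => absurd ⟨Classical.arbitrary V, by simp⟩ h⟩
  | succ n ih =>
    obtain ⟨v, hv, hmin⟩ := W.exists_min_image (fun w => #(W.filter (R w)))
      (card_pos.mp (by lia))
    set s := #(W.filter (R v)) with hsdef
    have hs0 : 0 < s := card_pos.mpr ⟨v, mem_filter.mpr ⟨hv, hr v⟩⟩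
    have hcard : #(W.erase v) = n := by rw [card_erase_of_mem hv, hn, Nat.add_sub_cancel]
    obtain ⟨M', b', hb', h2'⟩ := exists_eq_choose_two_add #(cliqueExps R (W.erase v) 2)
    have hrec2 := card_cliqueExps_two hr hs W hv
    have hrec3 := card_cliqueExps_succ hr hs W hv 2
    have hsW : s ≤ n + 1 := hn ▸ card_filter_le _ _
    -- Minimality of v leaves closed neighbourhoods of size at least s - 1 after deletion, so the
    -- remaining count is at least C(s,2).
    have hsM : s ≤ M' + 1 := by
      have h := choose_le_card_cliqueExps_two hr hs (s - 1) (W.erase v) (by lia)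
        fun w hw => by
          have h3 := hmin w (mem_of_mem_erase hw)
          have h4 := pred_card_le_card_erase (s := W.filter (R w)) (a := v)
          rw [filter_erase]
          lia
      by_contra! hlt
      have h5 : (M' + 2).choose 2 ≤ (s - 1 + 1).choose 2 := Nat.choose_le_choose 2 (by lia)
      rw [Nat.choose_succ_succ (M' + 1) 1, Nat.choose_one_right] at h5
      simp only [Nat.succ_eq_add_one] at *
      lia
    have hQ := card_cliqueExps_two_le hr hs (W.filter (R v))
    obtain ⟨hle, hlt⟩ := choose_three_add_le hb hb' hsM (by rw [← h2', ← h2, hrec2])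
    obtain ⟨ihle, ihlt⟩ := ih (W.erase v) hb' h2' hcard
    refine ⟨by lia, fun hns => ?_⟩
    by_cases hstar : ∃ u, ∀ i ∈ W.erase v, ∀ j ∈ W.erase v, ¬ R i j → i = u ∨ j = u
    swap
    · have := ihlt hstar
      lia
    obtain ⟨u, hu⟩ := hstar
    by_cases hclique : ∀ i ∈ W.filter (R v), ∀ j ∈ W.filter (R v), R i j
    swap
    · push Not at hclique
      obtain ⟨i, hi, j, hj, hij⟩ := hclique
      have := card_cliqueExps_two_lt hr hs hi hj hij
      lia
    push Not at hns
    -- Since v is not a center, an unrelated pair avoids v; this forces u into `W.erase v` and makes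
    -- its closed neighbourhood proper there, so M' = n - 1 and b' is its size.
    obtain ⟨x, hx, y, hy, hxy, hxv, hyv⟩ := hns v
    have hxe : x ∈ W.erase v := mem_erase.mpr ⟨hxv, hx⟩
    have hye : y ∈ W.erase v := mem_erase.mpr ⟨hyv, hy⟩
    have huW : u ∈ W.erase v := by
      rcases hu x hxe y hye hxy with rfl | rfl <;> assumption
    have hcenter := card_cliqueExps_two_of_center hr hs huW hu
    have hpos : 0 < #((W.erase v).filter (R u)) :=
      card_pos.mpr ⟨u, mem_filter.mpr ⟨huW, hr u⟩⟩
    have hless : #((W.erase v).filter (R u)) < n := by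
      rw [← hcard]
      refine card_lt_card (filter_ssubset.mpr ?_)
      rcases hu x hxe y hye hxy with rfl | rfl
      · exact ⟨y, hye, hxy⟩
      · exact ⟨x, hxe, fun h => hxy (hs _ _ h)⟩
    obtain ⟨m, rfl⟩ : ∃ m, n = m + 1 := ⟨n - 1, by lia⟩
    rw [hcard] at hcenter
    obtain ⟨rfl, rfl⟩ := choose_two_add_inj hb' (Nat.le_of_lt_succ hless)
      (by rw [← h2', hcenter])
    -- The closed neighbourhood of p misses both v and q, which bounds the minimum s.
    have key : ∀ p ∈ W, ∀ q ∈ W, p ≠ v → q ≠ v → ¬ R p q → ¬ R v p → s < M' + 1 := by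
      intro p hp q hq hpv hqv hpq hvp
      have h1 := hmin p hp
      have h2 : W.filter (R p) ⊆ (W.erase v).erase q := by
        intro i hi
        obtain ⟨hiW, hpi⟩ := mem_filter.mp hi
        refine mem_erase.mpr ⟨?_, mem_erase.mpr ⟨?_, hiW⟩⟩
        · rintro rfl
          exact hpq hpi
        · rintro rfl
          exact hvp (hs _ _ hpi)
      have h3 := card_le_card h2
      rw [card_erase_of_mem (mem_erase.mpr ⟨hqv, hq⟩), hcard] at h3
      lia
    have hsn : s < M' + 1 := by
      by_cases hvx : R v x
      · refine key y hy x hx hyv hxv (fun h => hxy (hs _ _ h)) fun hvy => hxy ?_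
        exact hclique x (mem_filter.mpr ⟨hx, hvx⟩) y (mem_filter.mpr ⟨hy, hvy⟩)
      · exact key x hx y hy hxv hyv hxy hvx
    have := hlt hpos hs0 hsn
    lia

end

/-! ### Hilbert functions of monomial ideals -/

section MonomialIdeals

variable {σ k : Type*} [Field k]

theorem finite_degree_inf [Finite σ] (I : Ideal (MvPolynomial σ k)) (d : ℕ) :
    Module.Finite k ↥(I.restrictScalars k ⊓ MvPolynomial.homogeneousSubmodule σ k d) := by
  have : Module.Finite k (MvPolynomial.homogeneousSubmodule σ k d) :=
    Module.Finite.iff_fg.mpr (MvPolynomial.homogeneousSubmodule_fg σ k d)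
  exact Submodule.finiteDimensional_inf_right _ _

theorem mem_homogeneousSubmodule_iff_support {d : ℕ} {f : MvPolynomial σ k} :
    f ∈ MvPolynomial.homogeneousSubmodule σ k d ↔ ∀ t ∈ f.support, t.degree = d := by
  rw [MvPolynomial.homogeneousSubmodule_eq_finsupp_supported]
  exact Iff.rfl

theorem hilbertFun_span_monomial (S : Set (σ →₀ ℕ)) (d : ℕ) :
    hilbertFun (Ideal.span ((fun s => MvPolynomial.monomial s (1 : k)) '' S)) d =
      {t : σ →₀ ℕ | t.degree = d ∧ ∃ s ∈ S, s ≤ t}.ncard := by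
  have h : (Ideal.span ((fun s => MvPolynomial.monomial s (1 : k)) '' S)).restrictScalars k ⊓
      MvPolynomial.homogeneousSubmodule σ k d =
      MvPolynomial.restrictSupport k {t : σ →₀ ℕ | t.degree = d ∧ ∃ s ∈ S, s ≤ t} := by
    ext f
    rw [Submodule.mem_inf, Submodule.restrictScalars_mem,
      MvPolynomial.mem_ideal_span_monomial_image, mem_homogeneousSubmodule_iff_support,
      MvPolynomial.mem_restrictSupport_iff]
    exact ⟨fun h t ht => ⟨h.2 t ht, h.1 t ht⟩, fun h => ⟨fun t ht => (h ht).2,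
      fun t ht => (h ht).1⟩⟩
  rw [hilbertFun, h, Module.finrank_eq_nat_card_basis (MvPolynomial.basisRestrictSupport k _)]
  rfl

theorem isHomogeneous_span_monomial (S : Set (σ →₀ ℕ)) :
    (Ideal.span ((fun s => MvPolynomial.monomial s (1 : k)) '' S)).IsHomogeneous
      (MvPolynomial.homogeneousSubmodule σ k) := by
  refine Ideal.homogeneous_span _ _ ?_
  rintro _ ⟨s, -, rfl⟩
  exact ⟨s.degree, MvPolynomial.isHomogeneous_monomial _ rfl⟩

theorem hilbertFun_span_monomial_add [Finite σ] (S : Set (σ →₀ ℕ)) (d : ℕ) :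
    hilbertFun (Ideal.span ((fun s => MvPolynomial.monomial s (1 : k)) '' S)) d +
      {t : σ →₀ ℕ | t.degree = d ∧ ¬ ∃ s ∈ S, s ≤ t}.ncard =
      {t : σ →₀ ℕ | t.degree = d}.ncard := by
  rw [hilbertFun_span_monomial,
    ← Set.ncard_inter_add_ncard_sdiff_eq_ncard {t : σ →₀ ℕ | t.degree = d}
      {t | ∃ s ∈ S, s ≤ t} (Finsupp.finite_of_degree_eq d)]
  rfl

end MonomialIdeals

/-! ### Edge ideals as monomial ideals -/

section EdgeIdeals

variable {V : Type*} (k : Type*) [Field k] (G : SimpleGraph V)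

/-- The exponents of the generators of the edge ideal. -/
def edgeExps : Set (V →₀ ℕ) :=
  {s | ∃ i j, G.Adj i j ∧ s = Finsupp.single i 1 + Finsupp.single j 1}

theorem edgeIdeal_eq_span_monomial :
    edgeIdeal k G =
      Ideal.span ((fun s => MvPolynomial.monomial s (1 : k)) '' edgeExps G) := by
  have h (i j : V) : (MvPolynomial.X i * MvPolynomial.X j : MvPolynomial V k) =
      MvPolynomial.monomial (Finsupp.single i 1 + Finsupp.single j 1) 1 := by
    simp [MvPolynomial.X, MvPolynomial.monomial_mul]
  rw [edgeIdeal]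
  congr 1
  ext f
  constructor
  · rintro ⟨i, j, hij, rfl⟩
    exact ⟨_, ⟨i, j, hij, rfl⟩, (h i j).symm⟩
  · rintro ⟨_, ⟨i, j, hij, rfl⟩, rfl⟩
    exact ⟨i, j, hij, (h i j).symm⟩

variable {G} in
theorem exists_edgeExps_le_iff {t : V →₀ ℕ} :
    (∃ s ∈ edgeExps G, s ≤ t) ↔ ∃ i ∈ t.support, ∃ j ∈ t.support, G.Adj i j := by
  constructor
  · rintro ⟨_, ⟨i, j, hij, rfl⟩, hle⟩
    refine ⟨i, ?_, j, ?_, hij⟩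
    · have := hle i
      rw [Finsupp.mem_support_iff]
      simp at this
      lia
    · have := hle j
      rw [Finsupp.mem_support_iff]
      simp at this
      lia
  · rintro ⟨i, hi, j, hj, hij⟩
    refine ⟨_, ⟨i, j, hij, rfl⟩, fun x => ?_⟩
    rw [Finsupp.mem_support_iff] at hi hj
    rcases eq_or_ne x i with rfl | hxi
    · simp [Finsupp.single_eq_of_ne hij.ne]
      lia
    · rcases eq_or_ne x j with rfl | hxj
      · simp [Finsupp.single_eq_of_ne hxi]
        lia
      · simp [Finsupp.single_eq_of_ne hxi, Finsupp.single_eq_of_ne hxj]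

variable [Fintype V]

theorem hilbertFun_edgeIdeal_add (d : ℕ) :
    hilbertFun (edgeIdeal k G) d + #(cliqueExps (fun i j => ¬ G.Adj i j) univ d) =
      {t : V →₀ ℕ | t.degree = d}.ncard := by
  rw [edgeIdeal_eq_span_monomial, ← hilbertFun_span_monomial_add (k := k) (edgeExps G) d,
    ← Set.ncard_coe_finset]
  congr 2
  ext t
  simp [mem_cliqueExps, exists_edgeExps_le_iff]

omit [Fintype V] in
theorem generatedInDegree_edgeIdeal : GeneratedInDegree (edgeIdeal k G) 2 := by
  refine ⟨_, ?_, rfl⟩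
  rintro _ ⟨i, j, -, rfl⟩
  exact (MvPolynomial.isHomogeneous_X k i).mul (MvPolynomial.isHomogeneous_X k j)

theorem ncard_degree_eq (d : ℕ) :
    {t : V →₀ ℕ | t.degree = d + 1}.ncard = (Fintype.card V + d).choose (d + 1) := by
  rw [← card_univ, ← card_cliqueExps_of_pairwise (R := fun _ _ : V => True) (by simp) (by simp)
    d univ (by simp), ← Set.ncard_coe_finset]
  congr 1
  ext t
  simp [mem_cliqueExps]

end EdgeIdeals

/-! ### Monomial ideals attaining Macaulay's growth -/

section LexIdeals

variable {V : Type*} [Fintype V]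

/-- The exponents supported on `A`, together with those of the form `a + t` with `t` supported
on `B`. -/
def smallExps (A B : Finset V) (a : V) : Set (V →₀ ℕ) :=
  {t | t.support ⊆ A ∨ ∃ u : V →₀ ℕ, u.support ⊆ B ∧ t = u + Finsupp.single a 1}

variable {A B : Finset V} {a : V}

omit [Fintype V] in
theorem isLowerSet_smallExps (hBA : B ⊆ A) : IsLowerSet (smallExps A B a) := by
  rintro t s hst (h | ⟨u, hu, rfl⟩)
  · exact Or.inl ((Finsupp.support_mono hst).trans h)
  · by_cases hs : s a = 0
    · left
      refine subset_trans (fun i hi => ?_) (hu.trans hBA)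
      have h1 := hst i
      have hia : i ≠ a := by
        rintro rfl
        exact Finsupp.mem_support_iff.mp hi hs
      rw [Finsupp.mem_support_iff] at hi ⊢
      simp [Finsupp.single_eq_of_ne hia] at h1
      lia
    · right
      have hle : Finsupp.single a 1 ≤ s := by
        rw [Finsupp.single_le_iff]
        exact Nat.one_le_iff_ne_zero.mpr hs
      obtain ⟨w, rfl⟩ := exists_add_of_le hle
      rw [add_comm _ w] at hst
      exact ⟨w, (Finsupp.support_mono (le_of_add_le_add_right hst)).trans hu, add_comm _ _⟩

theorem ncard_smallExps (haA : a ∉ A) (d : ℕ) :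
    {t : V →₀ ℕ | t.degree = d + 1 ∧ t ∈ smallExps A B a}.ncard =
      #(cliqueExps (fun _ _ => True) A (d + 1)) + #(cliqueExps (fun _ _ => True) B d) := by
  classical
  have hinj : Function.Injective fun t : V →₀ ℕ => t + Finsupp.single a 1 :=
    add_left_injective _
  rw [← card_image_of_injective (cliqueExps (fun _ _ => True) B d) hinj,
    ← card_union_of_disjoint, ← Set.ncard_coe_finset]
  · congr 1
    ext t
    simp only [smallExps, Set.mem_ofPred_eq, coe_union, coe_image, Set.mem_union, mem_coe,
      mem_cliqueExps, Set.mem_image]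
    constructor
    · rintro ⟨hd, h | ⟨u, hu, rfl⟩⟩
      · exact Or.inl ⟨hd, h, by simp⟩
      · exact Or.inr ⟨u, ⟨by simpa using hd, hu, by simp⟩, rfl⟩
    · rintro (⟨hd, h, -⟩ | ⟨u, ⟨hd, hu, -⟩, rfl⟩)
      · exact ⟨hd, Or.inl h⟩
      · exact ⟨by simp [hd], Or.inr ⟨u, hu, rfl⟩⟩
  · rw [disjoint_left]
    intro t ht ht'
    obtain ⟨u, -, rfl⟩ := mem_image.mp ht'
    refine haA ((mem_cliqueExps.mp ht).2.1 ?_)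
    simp

/-- Take |A| = M, B ⊆ A with |B| = b, and a outside A (hence M below the number of variables).
`smallExps` is a lower set, so it is exactly the complement of the ideal spanned by the other
monomials. -/
theorem exists_isHomogeneous_hilbertFun (k : Type*) [Field k] {M b : ℕ} (hb : b ≤ M)
    (hM : M < Fintype.card V) :
    ∃ J : Ideal (MvPolynomial V k),
      J.IsHomogeneous (MvPolynomial.homogeneousSubmodule V k) ∧
      hilbertFun J 2 + ((M + 1).choose 2 + b) = {t : V →₀ ℕ | t.degree = 2}.ncard ∧
      hilbertFun J 3 + ((M + 2).choose 3 + (b + 1).choose 2) =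
        {t : V →₀ ℕ | t.degree = 3}.ncard := by
  classical
  obtain ⟨A, -, hA⟩ := exists_subset_card_eq (s := (univ : Finset V)) (n := M)
    (by rw [card_univ]; lia)
  obtain ⟨B, hBA, hB⟩ := exists_subset_card_eq (s := A) (n := b) (by lia)
  obtain ⟨a, haA⟩ : ∃ a, a ∉ A := by
    by_contra! h
    rw [← card_univ, ← eq_univ_iff_forall.mpr h] at hM
    lia
  have hcompl (t : V →₀ ℕ) :
      t ∈ smallExps A B a ↔ ¬ ∃ s ∈ (smallExps A B a)ᶜ, s ≤ t := by
    refine ⟨?_, fun h => ?_⟩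
    · rintro ht ⟨s, hs, hst⟩
      exact hs (isLowerSet_smallExps hBA hst ht)
    · by_contra ht
      exact h ⟨t, ht, le_rfl⟩
  have hA' (d : ℕ) := card_cliqueExps_of_pairwise (R := fun _ _ : V => True) (by simp) (by simp)
    d A (by simp)
  have hB' (d : ℕ) := card_cliqueExps_of_pairwise (R := fun _ _ : V => True) (by simp) (by simp)
    d B (by simp)
  refine ⟨_, isHomogeneous_span_monomial (smallExps A B a)ᶜ, ?_, ?_⟩
  · rw [← hilbertFun_span_monomial_add (k := k) (smallExps A B a)ᶜ 2]
    simp_rw [← hcompl]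
    rw [ncard_smallExps haA 1, hA' 1, hB' 0, hA, hB]
    simp
  · rw [← hilbertFun_span_monomial_add (k := k) (smallExps A B a)ᶜ 3]
    simp_rw [← hcompl]
    rw [ncard_smallExps haA 2, hA' 2, hB' 1, hA, hB]

end LexIdeals

/-! ### Dimension versus leading exponents -/

section LeadingExponents

variable {σ k : Type*} [Field k]

theorem finrank_le_card_of_degree_mem (m : MonomialOrder σ) (W : Submodule k (MvPolynomial σ k))
    (D : Finset (σ →₀ ℕ)) (hD : ∀ f ∈ W, f ≠ 0 → m.degree f ∈ D) :
    Module.finrank k W ≤ #D := by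
  let φ : W →ₗ[k] (D → k) :=
    LinearMap.pi fun d => (MvPolynomial.lcoeff k d.1).comp W.subtype
  have hφ : Function.Injective φ := by
    rw [injective_iff_map_eq_zero]
    rintro ⟨f, hf⟩ h0
    by_contra hne
    have hf0 : f ≠ 0 := fun h => hne (Subtype.ext h)
    refine m.coeff_degree_ne_zero_iff.mpr hf0 ?_
    exact congrFun h0 ⟨m.degree f, hD f hf hf0⟩
  simpa using LinearMap.finrank_le_finrank_of_injective hφ

theorem card_le_finrank_of_degree (m : MonomialOrder σ) (W : Submodule k (MvPolynomial σ k))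
    [Module.Finite k W] (L : Finset (σ →₀ ℕ))
    (hL : ∀ t ∈ L, ∃ f ∈ W, f ≠ 0 ∧ m.degree f = t) :
    #L ≤ Module.finrank k W := by
  classical
  choose! f hfW hf0 hfd using hL
  have hli : LinearIndependent k fun t : L => (⟨f t, hfW t t.2⟩ : W) := by
    rw [Fintype.linearIndependent_iff]
    intro g hg
    by_contra! hne
    -- In a vanishing combination, the largest leading exponent with nonzero coefficient cannot
    -- cancel.
    obtain ⟨t, ht, hmax⟩ := (univ.filter fun t => g t ≠ 0).exists_max_image
      (fun t => m.toSyn t.1) (by obtain ⟨i, hi⟩ := hne; exact ⟨i, by simp [hi]⟩)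
    have h1 := congrArg (fun w : W => MvPolynomial.coeff t.1 (w : MvPolynomial σ k)) hg
    simp only [Submodule.coe_sum, Submodule.coe_smul, MvPolynomial.coeff_sum,
      MvPolynomial.coeff_smul, Submodule.coe_zero, MvPolynomial.coeff_zero] at h1
    rw [Finset.sum_eq_single t] at h1
    · have h2 := m.coeff_degree_ne_zero_iff.mpr (hf0 t t.2)
      rw [hfd t t.2] at h2
      exact (smul_ne_zero (mem_filter.mp ht).2 h2) h1
    · intro s _ hst
      by_cases hs : g s = 0
      · simp [hs]
      · have h3 := hmax s (by simp [hs])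
        rw [m.coeff_eq_zero_of_lt, smul_zero]
        rw [hfd s s.2]
        exact lt_of_le_of_ne h3 fun h => hst (Subtype.ext (m.toSyn.injective h))
    · simp
  simpa using hli.fintype_card_le_finrank

end LeadingExponents

/-! ### Counting multiples by a variable -/

section Multiples

variable {σ : Type*} [Fintype σ]

open Classical in
/-- The exponents of all products of a monomial with exponent in `D` and a variable. -/
def shadowExps (D : Finset (σ →₀ ℕ)) : Finset (σ →₀ ℕ) :=
  D.biUnion fun d => univ.image fun i => d + Finsupp.single i 1

omit [Fintype σ] in
theorem eq_of_add_single_eq {d e : σ →₀ ℕ} (hne : d ≠ e) {i j i' j' : σ}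
    (h : d + Finsupp.single i 1 = e + Finsupp.single j 1)
    (h' : d + Finsupp.single i' 1 = e + Finsupp.single j' 1) : i = i' := by
  classical
  by_contra hii
  have hij : i ≠ j := by
    rintro rfl
    exact hne (add_right_cancel h)
  have h1 := DFunLike.congr_fun h i
  have h2 := DFunLike.congr_fun h' i
  simp [Finsupp.single_apply, hij.symm, Ne.symm hii] at h1 h2
  lia

theorem card_mul_le_card_shadowExps_add (D : Finset (σ →₀ ℕ)) :
    Fintype.card σ * #D ≤ #(shadowExps D) + (#D).choose 2 := by
  classical
  induction D using Finset.induction_on with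
  | empty => simp
  | insert d D hd ih =>
    set N : Finset (σ →₀ ℕ) := univ.image fun i => d + Finsupp.single i 1 with hN
    have hNcard : #N = Fintype.card σ := by
      rw [hN, card_image_of_injective, card_univ]
      intro i j hij
      exact Finsupp.single_left_injective one_ne_zero (add_left_cancel hij)
    have hunion : shadowExps (insert d D) = N ∪ shadowExps D := by
      rw [shadowExps, biUnion_insert, shadowExps]
    -- Each earlier exponent accounts for at most one of the new multiples.
    have hinter : #(N ∩ shadowExps D) ≤ #D := by
      have hmem (t) (ht : t ∈ N ∩ shadowExps D) :
          ∃ e ∈ D, ∃ j, e + Finsupp.single j 1 = t := by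
        simpa [shadowExps] using (mem_inter.mp ht).2
      choose! e heD j hej using hmem
      refine card_le_card_of_injOn e (fun t ht => heD t ht) ?_
      intro t ht t' ht' hee
      obtain ⟨i, -, hi⟩ := mem_image.mp (mem_inter.mp ht).1
      obtain ⟨i', -, hi'⟩ := mem_image.mp (mem_inter.mp ht').1
      have hne : d ≠ e t := fun h => hd (h ▸ heD t ht)
      have := eq_of_add_single_eq hne (hi.trans (hej t ht).symm)
        (hi'.trans ((hej t' ht').symm.trans (by rw [hee])))
      rw [← hi, ← hi', this]
    have hcard := card_union_add_card_inter N (shadowExps D)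
    rw [hunion, card_insert_of_notMem hd, Nat.choose_succ_succ (#D) 1, Nat.choose_one_right,
      mul_add, mul_one]
    simp only [Nat.succ_eq_add_one] at *
    lia

end Multiples

/-! ### Macaulay's lower bound and the two implications -/

/-- Macaulay's lower bound on the growth of an ideal, for at most as many forms as variables. -/
theorem card_mul_hilbertFun_le {n : ℕ} {k : Type*} [Field k] (J : Ideal (MvPolynomial (Fin n) k))
    (d : ℕ) :
    n * hilbertFun J d ≤ hilbertFun J (d + 1) + (hilbertFun J d).choose 2 := by
  classical
  let m : MonomialOrder (Fin n) := MonomialOrder.lex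
  set W := J.restrictScalars k ⊓ MvPolynomial.homogeneousSubmodule (Fin n) k d with hW
  let D := (finsuppAntidiag (univ : Finset (Fin n)) d).filter
    fun t => ∃ f ∈ W, f ≠ 0 ∧ m.degree f = t
  have hD : hilbertFun J d ≤ #D := by
    refine finrank_le_card_of_degree_mem m W D fun f hf hf0 => ?_
    refine mem_filter.mpr ⟨?_, f, hf, hf0, rfl⟩
    have := mem_homogeneousSubmodule_iff_support.mp hf.2 _ (m.degree_mem_support hf0)
    simpa [Finsupp.degree_eq_sum] using this
  -- The bound n * m - C(m,2) is not monotone in m, so the exact cardinality is needed.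
  obtain ⟨D', hD'D, hD'⟩ := exists_subset_card_eq hD
  have : Module.Finite k ↥(J.restrictScalars k ⊓
      MvPolynomial.homogeneousSubmodule (Fin n) k (d + 1)) := finite_degree_inf J (d + 1)
  have hL : #(shadowExps D') ≤ hilbertFun J (d + 1) := by
    refine card_le_finrank_of_degree m _ _ fun t ht => ?_
    simp only [shadowExps, mem_biUnion, mem_image, mem_univ, true_and] at ht
    obtain ⟨e, he, i, rfl⟩ := ht
    obtain ⟨-, f, hf, hf0, rfl⟩ := mem_filter.mp (hD'D he)
    refine ⟨f * MvPolynomial.X i, ⟨J.mul_mem_right _ hf.1, ?_⟩,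
      mul_ne_zero hf0 (MvPolynomial.X_ne_zero i), ?_⟩
    · exact MvPolynomial.IsHomogeneous.mul hf.2 (MvPolynomial.isHomogeneous_X k i)
    · rw [m.degree_mul hf0 (MvPolynomial.X_ne_zero i), m.degree_X]
  have := card_mul_le_card_shadowExps_add D'
  rw [hD', Fintype.card_fin] at this
  lia

theorem isStar_iff {n : ℕ} (G : SimpleGraph (Fin n)) :
    IsStar G ↔ ∃ u, ∀ i j, G.Adj i j → i = u ∨ j = u := by
  classical
  rw [IsStar]
  refine exists_congr fun u => ?_
  rw [← G.card_incidenceFinset_eq_degree]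
  have hsub := G.incidenceFinset_subset u
  constructor
  · intro h i j hij
    have heq := eq_of_subset_of_card_le hsub h.ge
    have hmem : s(i, j) ∈ G.incidenceFinset u := by
      rw [heq, SimpleGraph.mem_edgeFinset]
      exact hij
    rw [SimpleGraph.mem_incidenceFinset] at hmem
    have := hmem.2
    rw [Sym2.mem_iff] at this
    exact this.imp Eq.symm Eq.symm
  · intro h
    congr 1
    refine subset_antisymm hsub fun e he => ?_
    induction e with
    | _ i j =>
      rw [SimpleGraph.mem_edgeFinset] at he
      rw [SimpleGraph.mem_incidenceFinset]
      exact ⟨he, Sym2.mem_iff.mpr ((h i j he).imp Eq.symm Eq.symm)⟩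

theorem exists_card_cliqueExps_of_center {V : Type*} [Fintype V] {R : V → V → Prop}
    (hr : ∀ i, R i i) (hs : ∀ i j, R i j → R j i) (u : V)
    (hu : ∀ i j, ¬ R i j → i = u ∨ j = u) :
    ∃ q s, q + 1 = Fintype.card V ∧ #(cliqueExps R univ 2) = (q + 1).choose 2 + s ∧
      #(cliqueExps R univ 3) = (q + 2).choose 3 + (s + 1).choose 2 := by
  classical
  have hne : ∀ i ∈ univ.erase u, ∀ j ∈ univ.erase u, R i j := by
    intro i hi j hj
    by_contra hij
    rcases hu i j hij with rfl | rfl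
    · exact notMem_erase _ _ hi
    · exact notMem_erase _ _ hj
  have hclique : ∀ i ∈ univ.filter (R u), ∀ j ∈ univ.filter (R u), R i j := by
    intro i hi j hj
    by_contra hij
    rcases hu i j hij with rfl | rfl
    · exact hij (mem_filter.mp hj).2
    · exact hij (hs _ _ (mem_filter.mp hi).2)
  refine ⟨#(univ.erase u), #(univ.filter (R u)), ?_, ?_, ?_⟩
  · rw [card_erase_add_one (mem_univ u), card_univ]
  · rw [card_cliqueExps_two hr hs _ (mem_univ u), card_cliqueExps_of_pairwise hr hs 1 _ hne]
  · rw [card_cliqueExps_succ hr hs _ (mem_univ u), card_cliqueExps_of_pairwise hr hs 2 _ hne,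
      card_cliqueExps_of_pairwise hr hs 1 _ hclique]

theorem isGotzmann_of_center {k : Type*} [Field k] {n : ℕ} (G : SimpleGraph (Fin n)) (u : Fin n)
    (hu : ∀ i j, G.Adj i j → i = u ∨ j = u) : IsGotzmann (edgeIdeal k G) 2 := by
  refine ⟨?_, generatedInDegree_edgeIdeal k G, fun J _ hJ => ?_⟩
  · rw [edgeIdeal_eq_span_monomial]
    exact isHomogeneous_span_monomial _
  obtain ⟨q, s, hq, hq2, hq3⟩ := exists_card_cliqueExps_of_center (R := fun i j => ¬ G.Adj i j)
    (fun i => G.loopless.irrefl i) (fun i j h h' => h h'.symm) u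
    (fun i j hij => hu i j (not_not.mp hij))
  have h2 := hilbertFun_edgeIdeal_add k G 2
  have h3 := hilbertFun_edgeIdeal_add k G 3
  rw [ncard_degree_eq, ← hq, hq2] at h2
  rw [ncard_degree_eq, ← hq, hq3] at h3
  have hJ3 := card_mul_hilbertFun_le J 2
  have hn : n = q + 1 := by rw [hq, Fintype.card_fin]
  rw [← hJ] at hJ3
  simp only [Nat.reduceAdd] at h2 h3 hJ3 ⊢
  generalize hilbertFun (edgeIdeal k G) 2 = m at *
  generalize hilbertFun (edgeIdeal k G) 3 = p at *
  generalize hilbertFun J 3 = r at *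
  rw [hn] at hJ3
  have e1 : (q + 1 + 1).choose 2 = (q + 1).choose 2 + (q + 1) := by
    rw [Nat.choose_succ_succ (q + 1) 1, Nat.choose_one_right, add_comm]
  have e2 : (q + 1 + 2).choose 3 = (q + 2).choose 3 + (q + 1 + 1).choose 2 := by
    rw [Nat.choose_succ_succ (q + 2) 2, add_comm]
  have e3 := two_mul_choose_two (q + 1)
  have e4 := two_mul_choose_two s
  cases m with
  | zero =>
    obtain rfl : s = q + 1 := by lia
    lia
  | succ m =>
    have e5 := two_mul_choose_two m
    obtain rfl : q = m + s := by lia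
    nlinarith

theorem isStar_of_isGotzmann {k : Type*} [Field k] {n : ℕ} (hn : 0 < n)
    (G : SimpleGraph (Fin n)) (hG : IsGotzmann (edgeIdeal k G) 2) :
    ∃ u, ∀ i j, G.Adj i j → i = u ∨ j = u := by
  by_contra hstar
  have : Nonempty (Fin n) := ⟨⟨0, hn⟩⟩
  have hr : ∀ i, ¬ G.Adj i i := fun i => G.loopless.irrefl i
  have hs : ∀ i j, ¬ G.Adj i j → ¬ G.Adj j i := fun i j h h' => h h'.symm
  obtain ⟨M, b, hb, h2⟩ :=
    exists_eq_choose_two_add #(cliqueExps (fun i j => ¬ G.Adj i j) univ 2)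
  have h3 := (card_cliqueExps_three_le hr hs univ hb h2).2 (by simpa using hstar)
  -- A non-star has an edge, so fewer than C(n+1,2) quadratic monomials lie outside the ideal.
  have hM : M < Fintype.card (Fin n) := by
    push Not at hstar
    obtain ⟨i, j, hij, -⟩ := hstar ⟨0, hn⟩
    have h4 := card_cliqueExps_two_lt hr hs (mem_univ i) (mem_univ j) (not_not.mpr hij)
    rw [card_univ] at h4
    by_contra! hle
    have h5 : (Fintype.card (Fin n) + 1).choose 2 ≤ (M + 1).choose 2 :=
      Nat.choose_le_choose 2 (by lia)
    lia
  obtain ⟨J, hJ, hJ2, hJ3⟩ := exists_isHomogeneous_hilbertFun k hb hM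
  have hI2 := hilbertFun_edgeIdeal_add k G 2
  have hI3 := hilbertFun_edgeIdeal_add k G 3
  have := hG.2.2 J hJ (by lia)
  simp only [Nat.reduceAdd] at this
  lia

end GotzmannEdge

end

theorem mainTheorem1 {k : Type*} [Field k] {n : ℕ} (hn : 0 < n) (G : SimpleGraph (Fin n)) :
    GotzmannEdge.IsGotzmann (GotzmannEdge.edgeIdeal k G) 2 ↔ GotzmannEdge.IsStar G := by
  rw [GotzmannEdge.isStar_iff]
  exact ⟨GotzmannEdge.isStar_of_isGotzmann hn G,
    fun ⟨u, hu⟩ => GotzmannEdge.isGotzmann_of_center G u hu⟩
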